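/- Let $L$ be the space of real $4\times4$ matrices $M=\begin{bmatrix}A&B\\C&D\end{bmatrix}$ (with $2\times 2$ blocks), let $\Sigma=\{M\in L:\operatorname{rank}M=2\}$, a connected submanifold of codimension $4$, and let $U=\{M\in L:\det A\neq0\}$. Orient the normal bundle of $\Sigma$ by the canonical orientation of its fibres $\operatorname{Hom}(\ker M,\operatorname{coker}M)$; equivalently, by the unique global orientation which over $\Sigma\cap\{\det A>0\}$ is given by the coordinates $(d_{11},d_{12},d_{21},d_{22})$ of $D$. If $p\in\mathbb R^4$ and $m$ is a continuous map from a neighbourhood of $p$ to $L$ such that $p$ is isolated in $m^{-1}(\Sigma)$, let the index $I_p(m)\in\mathbb Z$ be the intersection number of $m$ with $\Sigma$ at $m(p)$, i.e. the local topological degree at $p$ of $g\circ m:(\mathbb R^4,p)\to(\mathbb R^4,0)$, where $g=0$ is a local $C^1$ equation of $\Sigma$ near $m(p)$, with values in $\mathbb R^4$, whose derivative at $m(p)$ induces an orientation preserving isomorphism from the normal space of $\Sigma$ onto $\mathbb R^4$. Write $I(m)=I_0(m)$. **Proposition.** Let $V$ be an open neighbourhood of the origin in $\mathbb R^4$ and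 let $m:V\to L$ be a continuous map such that $0$ is isolated in $m^{-1}(\Sigma)$. Let $\tau:L\to L$ be a composition of a finite sequence of $3$-cyclic permutations of rows or columns such that $\tau(m(0))\in\Sigma\cap U$. Then $I(m)=I(\tau\circ m)$. -/

import Mathlib

open Topology Filter Matrix
open scoped Matrix.Norms.Elementwise

namespace RankTwo

noncomputable section

open CategoryTheory

/-- Euclidean four-space, with its standard orientation. -/
abbrev E4 : Type := EuclideanSpace ℝ (Fin 4)

/-- The space `L` of real `4 × 4` matrices. -/
abbrev L : Type := Matrix (Fin 4) (Fin 4) ℝ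

/-- `Σ`: the matrices of rank two. -/
def Sig : Set L := {M | M.rank = 2}

/-- `U`: the matrices whose upper left `2 × 2` block `A` is invertible. -/
def U : Set L := {M | (M.submatrix ![0, 1] ![0, 1]).det ≠ 0}

/-! ### Orientation of the normal bundle of `Σ`

The tangent space of `Σ` at `M` consists of the `X` with `X (ker M) ⊆ im M`, so the normal space
`L ⧸ T_M Σ` is `Hom (ker M, coker M)`. If `l₀, l₁` is a basis of the left kernel of `M` and `k₀, k₁`
a basis of its kernel, then `X ↦ (lᵢ ⬝ X kⱼ)` are linear coordinates on the normal space.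
Changing the bases by `P, Q ∈ GL₂` changes these coordinates by `P ⊗ Q`, whose determinant is
`(det P)² (det Q)² > 0`, so they orient the normal space independently of all choices. -/

/-- `l` is a basis of the left kernel and `k` a basis of the kernel of the rank two matrix `M`. -/
structure IsKernelBases (M : L) (l k : Fin 2 → Fin 4 → ℝ) : Prop where
  left_indep : LinearIndependent ℝ l
  left_ker : ∀ i, l i ᵥ* M = 0
  right_indep : LinearIndependent ℝ k
  right_ker : ∀ j, M *ᵥ k j = 0

/-- The coordinates `lᵢ ⬝ F_b kⱼ` of four matrices `F_b` in the normal space. -/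
def normalCoord (l k : Fin 2 → Fin 4 → ℝ) (F : Fin 2 × Fin 2 → L) :
    Matrix (Fin 2 × Fin 2) (Fin 2 × Fin 2) ℝ :=
  Matrix.of fun a b => l a.1 ⬝ᵥ (F b *ᵥ k a.2)

/-- The classes of the four matrices `F_b` form a positively oriented basis of the normal space of
`Σ` at `M`. -/
def IsPositiveNormalFrame (M : L) (F : Fin 2 × Fin 2 → L) : Prop :=
  ∃ l k, IsKernelBases M l k ∧ 0 < (normalCoord l k F).det

/-- The coordinate directions `d₁₁, d₁₂, d₂₁, d₂₂` of the lower right block. -/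
def dFrame (b : Fin 2 × Fin 2) : L :=
  Matrix.single (![2, 3] b.1) (![2, 3] b.2) 1

theorem kernel_span (M : L) (hM : M.rank = 2) (k : Fin 2 → Fin 4 → ℝ)
    (hk : LinearIndependent ℝ k) (h0 : ∀ j, M *ᵥ k j = 0) (v : Fin 4 → ℝ) (hv : M *ᵥ v = 0) :
    ∃ c : Fin 2 → ℝ, v = ∑ j, c j • k j := by
  have hd : Module.finrank ℝ (LinearMap.ker M.mulVecLin) = 2 := by
    have := M.mulVecLin.finrank_range_add_finrank_ker
    rw [Matrix.rank] at hM
    simp [hM] at this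
    omega
  have hle : Submodule.span ℝ (Set.range k) ≤ LinearMap.ker M.mulVecLin := by
    rw [Submodule.span_le]
    rintro _ ⟨j, rfl⟩
    simpa using h0 j
  have heq := Submodule.eq_of_le_of_finrank_eq hle (by rw [finrank_span_eq_card hk, hd]; simp)
  have hv' : v ∈ Submodule.span ℝ (Set.range k) := by rw [heq]; simpa using hv
  rw [Submodule.mem_span_range_iff_exists_fun] at hv'
  obtain ⟨c, hc⟩ := hv'
  exact ⟨c, hc.symm⟩

theorem change_det_ne_zero (k k' : Fin 2 → Fin 4 → ℝ) (hk' : LinearIndependent ℝ k')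
    (Q : Matrix (Fin 2) (Fin 2) ℝ) (hQ : ∀ i, k' i = ∑ j, Q i j • k j) : Q.det ≠ 0 := by
  intro h
  obtain ⟨v, hv, hv0⟩ := Matrix.exists_vecMul_eq_zero_iff.mpr h
  apply hv
  funext i
  refine Fintype.linearIndependent_iff.mp hk' v ?_ i
  simp_rw [hQ, Finset.smul_sum, smul_smul]
  rw [Finset.sum_comm]
  simp_rw [← Finset.sum_smul]
  have : ∀ j, ∑ i, v i * Q i j = 0 := fun j => congrFun hv0 j
  simp [this]

/-- Positivity of a normal frame does not depend on the bases of the kernels. -/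
theorem IsPositiveNormalFrame.pos {M : L} (hM : M ∈ Sig) {F : Fin 2 × Fin 2 → L}
    (h : IsPositiveNormalFrame M F) {l' k' : Fin 2 → Fin 4 → ℝ} (h' : IsKernelBases M l' k') :
    0 < (normalCoord l' k' F).det := by
  obtain ⟨l, k, hlk, hpos⟩ := h
  choose P hP using fun i => kernel_span Mᵀ (by rw [Matrix.rank_transpose]; exact hM) l
    hlk.left_indep (fun j => by rw [Matrix.mulVec_transpose]; exact hlk.left_ker j) (l' i)
    (by rw [Matrix.mulVec_transpose]; exact h'.left_ker i)
  choose Q hQ using fun i => kernel_span M hM k hlk.right_indep hlk.right_ker (k' i)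
    (h'.right_ker i)
  have hP0 := change_det_ne_zero l l' h'.left_indep (Matrix.of P) hP
  have hQ0 := change_det_ne_zero k k' h'.right_indep (Matrix.of Q) hQ
  have key : normalCoord l' k' F =
      Matrix.kroneckerMap (· * ·) (Matrix.of P) (Matrix.of Q) * normalCoord l k F := by
    ext ⟨i, j⟩ b
    simp only [normalCoord, Matrix.of_apply, Matrix.mul_apply, Fintype.sum_prod_type,
      Matrix.kroneckerMap_apply, hP i, hQ j, Fin.sum_univ_two, Matrix.mulVec_add,
      Matrix.mulVec_smul, dotProduct_add, add_dotProduct, smul_dotProduct, dotProduct_smul,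
      smul_eq_mul]
    ring
  rw [key, Matrix.det_mul, Matrix.det_kronecker]
  simp only [Fintype.card_fin]
  have := sq_pos_of_ne_zero hP0
  have := sq_pos_of_ne_zero hQ0
  positivity


def OrthonormalRows (l : Fin 2 → Fin 4 → ℝ) : Prop := ∀ i j, l i ⬝ᵥ l j = if i = j then 1 else 0

theorem OrthonormalRows.indep {l : Fin 2 → Fin 4 → ℝ} (h : OrthonormalRows l) :
    LinearIndependent ℝ l := by
  rw [Fintype.linearIndependent_iff]
  intro c hc i
  have := congrArg (fun v => l i ⬝ᵥ v) hc
  fin_cases i <;> simpa [dotProduct_sum, dotProduct_smul, h _ _] using this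

theorem exists_orthonormal_ker {M : L} (hM : M.rank = 2) :
    ∃ k : Fin 2 → Fin 4 → ℝ, OrthonormalRows k ∧ ∀ j, M *ᵥ k j = 0 := by
  let K : Submodule ℝ E4 := LinearMap.ker
    (M.mulVecLin ∘ₗ (WithLp.linearEquiv 2 ℝ (Fin 4 → ℝ)).toLinearMap)
  have hd : Module.finrank ℝ K = 2 := by
    have := (M.mulVecLin ∘ₗ
      (WithLp.linearEquiv 2 ℝ (Fin 4 → ℝ)).toLinearMap).finrank_range_add_finrank_ker
    rw [LinearEquiv.range_comp, ← Matrix.rank, hM, finrank_euclideanSpace] at this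
    have h4 : 2 + Module.finrank ℝ K = 4 := this
    omega
  let b := (stdOrthonormalBasis ℝ K).reindex (finCongr hd)
  refine ⟨fun j => (b j : E4).ofLp, fun i j => ?_, fun j => ?_⟩
  · have := orthonormal_iff_ite.mp b.orthonormal j i
    rw [Submodule.coe_inner, EuclideanSpace.inner_eq_star_dotProduct] at this
    simpa [eq_comm] using this
  · exact LinearMap.mem_ker.mp (b j).2

theorem exists_kernelBases {M : L} (hM : M ∈ Sig) :
    ∃ l k, OrthonormalRows l ∧ OrthonormalRows k ∧ IsKernelBases M l k := by
  obtain ⟨k, hk, hk0⟩ := exists_orthonormal_ker (M := M) hM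
  obtain ⟨l, hl, hl0⟩ := exists_orthonormal_ker (M := Mᵀ) (by rw [Matrix.rank_transpose]; exact hM)
  exact ⟨l, k, hl, hk, hl.indep, fun i => by rw [← Matrix.mulVec_transpose]; exact hl0 i,
    hk.indep, hk0⟩

theorem lower_det_ne_zero {M : L} (hM : M ∈ U) {k : Fin 2 → Fin 4 → ℝ}
    (hk : LinearIndependent ℝ k) (h0 : ∀ j, M *ᵥ k j = 0) :
    (Matrix.of fun i b : Fin 2 => k i (![2, 3] b)).det ≠ 0 := by
  intro h
  obtain ⟨c, hc, hc0⟩ := Matrix.exists_vecMul_eq_zero_iff.mpr h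
  have h2 : c 0 * k 0 2 + c 1 * k 1 2 = 0 := by
    simpa [Matrix.vecMul, dotProduct, Fin.sum_univ_two] using congrFun hc0 0
  have h3 : c 0 * k 0 3 + c 1 * k 1 3 = 0 := by
    simpa [Matrix.vecMul, dotProduct, Fin.sum_univ_two] using congrFun hc0 1
  have hA : M.submatrix ![0, 1] ![0, 1] *ᵥ
      ![c 0 * k 0 0 + c 1 * k 1 0, c 0 * k 0 1 + c 1 * k 1 1] = 0 := by
    have e0 := fun i => congrFun (h0 0) i
    have e1 := fun i => congrFun (h0 1) i
    simp only [Matrix.mulVec, dotProduct, Fin.sum_univ_four, Pi.zero_apply] at e0 e1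
    funext i
    fin_cases i
    · simp [Matrix.mulVec, dotProduct, Fin.sum_univ_two]
      linear_combination c 0 * e0 0 + c 1 * e1 0 - M 0 2 * h2 - M 0 3 * h3
    · simp [Matrix.mulVec, dotProduct, Fin.sum_univ_two]
      linear_combination c 0 * e0 1 + c 1 * e1 1 - M 1 2 * h2 - M 1 3 * h3
  have hz := Matrix.eq_zero_of_mulVec_eq_zero hM hA
  have z0 := congrFun hz 0
  have z1 := congrFun hz 1
  simp at z0 z1
  apply hc
  funext i
  refine Fintype.linearIndependent_iff.mp hk c ?_ i
  funext j
  fin_cases j <;> simpa [Fin.sum_univ_two]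

/-- Over `Σ ∩ U` the orientation is that of the coordinates `(d₁₁, d₁₂, d₂₁, d₂₂)`. -/
theorem isPositiveNormalFrame_dFrame {M : L} (hM : M ∈ Sig) (hU : M ∈ U) :
    IsPositiveNormalFrame M dFrame := by
  obtain ⟨l, k, -, -, hlk⟩ := exists_kernelBases hM
  refine ⟨l, k, hlk, ?_⟩
  have hk := lower_det_ne_zero hU hlk.right_indep hlk.right_ker
  have hl := lower_det_ne_zero (M := Mᵀ)
    (by
      have : (M.submatrix ![0, 1] ![0, 1]).det ≠ 0 := hU
      rwa [← Matrix.det_transpose] at this) hlk.left_indep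
    (fun i => by rw [Matrix.mulVec_transpose]; exact hlk.left_ker i)
  have key : normalCoord l k dFrame = Matrix.kroneckerMap (· * ·)
      (Matrix.of fun i b : Fin 2 => l i (![2, 3] b))
      (Matrix.of fun i b : Fin 2 => k i (![2, 3] b)) := by
    ext ⟨i, j⟩ ⟨a, b⟩
    simp [normalCoord, dFrame, Matrix.single_mulVec_eq, Matrix.kroneckerMap_apply, mul_comm]
  rw [key, Matrix.det_kronecker]
  have := sq_pos_of_ne_zero hk
  have := sq_pos_of_ne_zero hl
  simp only [Fintype.card_fin]
  positivity

/-- The orientation of the normal spaces varies continuously along `Σ`. -/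
theorem IsPositiveNormalFrame.eventually {M₀ : L} (hM₀ : M₀ ∈ Sig) {F : Fin 2 × Fin 2 → L}
    (h : IsPositiveNormalFrame M₀ F) :
    ∀ᶠ M in 𝓝[Sig] M₀, IsPositiveNormalFrame M F := by
  let C : Set (Fin 2 → Fin 4 → ℝ) := Set.Icc (fun _ _ => -1) (fun _ _ => 1)
  have hC : ∀ l, OrthonormalRows l → l ∈ C := by
    intro l hl
    have : ∀ i j, l i j ^ 2 ≤ 1 := by
      intro i j
      have h1 := hl i i
      simp only [dotProduct, if_true] at h1
      rw [← h1, sq]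
      exact Finset.single_le_sum (f := fun j => l i j * l i j)
        (fun j _ => mul_self_nonneg _) (Finset.mem_univ j)
    exact ⟨fun i j => by have := this i j; simp only; nlinarith,
      fun i j => by have := this i j; simp only; nlinarith⟩
  let K := C ×ˢ C
  have hK : IsCompact K := isCompact_Icc.prod isCompact_Icc
  have : CompactSpace K := isCompact_iff_compactSpace.mp hK
  let S : Set (L × K) :=
    {q | ∀ i j, q.2.1.1 i ⬝ᵥ q.2.1.1 j = if i = j then 1 else 0} ∩
    ({q | ∀ i j, q.2.1.2 i ⬝ᵥ q.2.1.2 j = if i = j then 1 else 0} ∩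
    ({q | ∀ i, q.2.1.1 i ᵥ* q.1 = 0} ∩ ({q | ∀ i, q.1 *ᵥ q.2.1.2 i = 0} ∩
      {q | (normalCoord q.2.1.1 q.2.1.2 F).det ≤ 0})))
  have hS : IsClosed S := by
    refine IsClosed.inter ?_ (IsClosed.inter ?_ (IsClosed.inter ?_ (IsClosed.inter ?_ ?_)))
    · simp only [Set.ofPred_forall]
      exact isClosed_iInter fun i => isClosed_iInter fun j =>
        isClosed_eq (by unfold dotProduct; fun_prop) continuous_const
    · simp only [Set.ofPred_forall]
      exact isClosed_iInter fun i => isClosed_iInter fun j =>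
        isClosed_eq (by unfold dotProduct; fun_prop) continuous_const
    · simp only [Set.ofPred_forall]
      exact isClosed_iInter fun i => isClosed_eq
        (Continuous.matrix_vecMul (by fun_prop) (by fun_prop)) continuous_const
    · simp only [Set.ofPred_forall]
      exact isClosed_iInter fun i => isClosed_eq
        (Continuous.matrix_mulVec (by fun_prop) (by fun_prop)) continuous_const
    · refine isClosed_le (Continuous.matrix_det ?_) continuous_const
      refine continuous_matrix fun a b => ?_
      simp only [normalCoord, Matrix.of_apply, dotProduct, Matrix.mulVec]
      fun_prop
  have hnot : M₀ ∉ Prod.fst '' S := by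
    rintro ⟨⟨M, ⟨l, k⟩, hq⟩, ⟨h1, h2, h3, h4, h5⟩, hMM⟩
    obtain rfl : M = M₀ := hMM
    exact absurd (h.pos hM₀ ⟨OrthonormalRows.indep h1, h3, OrthonormalRows.indep h2, h4⟩)
      (not_lt.mpr h5)
  have hcl : IsClosed (Prod.fst '' S) := isClosedMap_fst_of_compactSpace S hS
  have hev : ∀ᶠ M in 𝓝 M₀, M ∉ Prod.fst '' S :=
    hcl.isOpen_compl.mem_nhds hnot
  filter_upwards [nhdsWithin_le_nhds hev, self_mem_nhdsWithin] with M hM hMS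
  obtain ⟨l, k, hl, hk, hlk⟩ := exists_kernelBases hMS
  refine ⟨l, k, hlk, ?_⟩
  by_contra hneg
  exact hM ⟨⟨M, ⟨l, k⟩, hC l hl, hC k hk⟩,
    ⟨hl, hk, hlk.left_ker, hlk.right_ker, not_lt.mp hneg⟩, rfl⟩

/-- `g` is a local equation `g = 0` of `Σ` near `M₀ ∈ Σ` with values in `ℝ⁴`, of class `C¹`, whose
derivative at `M₀` maps positively oriented bases of the normal space of `Σ` to positively oriented
bases of `ℝ⁴`. The pairs `(1,1), (1,2), (2,1), (2,2)` are numbered in this order. -/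
structure IsOrientedEquation (g : L → E4) (M₀ : L) : Prop where
  mem : M₀ ∈ Sig
  contDiffAt : ContDiffAt ℝ 1 g M₀
  eq_zero_iff : ∀ᶠ M in 𝓝 M₀, g M = 0 ↔ M ∈ Sig
  oriented : ∃ F : Fin 2 × Fin 2 → L, IsPositiveNormalFrame M₀ F ∧
    0 < (Matrix.of fun a b : Fin 4 => (fderiv ℝ g M₀ (F (finProdFinEquiv.symm b))) a).det

/-! ### Local topological degree -/

/-- The third integral singular homology functor. -/
abbrev H3 : TopCat.{0} ⥤ ModuleCat.{0} ℤ :=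
  (AlgebraicTopology.singularHomologyFunctor (ModuleCat.{0} ℤ) 3).obj (ModuleCat.of ℤ ℤ)

/-- The map `H₃(X; ℤ) → H₃(Y; ℤ)` induced by a continuous map. -/
def H3map {X Y : Type} [TopologicalSpace X] [TopologicalSpace Y] (φ : C(X, Y)) :
    H3.obj (TopCat.of X) ⟶ H3.obj (TopCat.of Y) :=
  H3.map (TopCat.ofHom φ)

/-- `f : (ℝ⁴, p) → (ℝ⁴, 0)`, with `p` isolated in `f ⁻¹ (0)`, has local topological degree `d` at `p`:
for all small `r > 0`, the map `f` from the sphere of radius `r` about `p` to `ℝ⁴ ∖ {0}` induces on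
third homology `d` times the map induced by `x ↦ x - p` (which is an isomorphism `ℤ ≅ ℤ`). -/
def HasLocalDegree (f : E4 → E4) (p : E4) (d : ℤ) : Prop :=
  f p = 0 ∧ ∀ᶠ r : ℝ in 𝓝[>] 0, ∃ φ ι : C(Metric.sphere p r, {y : E4 // y ≠ 0}),
    (∀ x, (φ x : E4) = f x) ∧ (∀ x, (ι x : E4) = x - p) ∧ H3map φ = d • H3map ι

/-! ### The intersection index -/

/-- `d` is the intersection number of `m` with `Σ` at `m p`: the local degree at `p` of `g ∘ m`, with
`g` an oriented local equation of `Σ` near `m p`. -/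
def HasIndex (m : E4 → L) (p : E4) (d : ℤ) : Prop :=
  ∃ g : L → E4, IsOrientedEquation g (m p) ∧ HasLocalDegree (g ∘ m) p d

open Classical in
/-- The intersection index `I_p(m)`: the unique integer `d` with `HasIndex m p d`. -/
def index (m : E4 → L) (p : E4) : ℤ :=
  if h : ∃! d : ℤ, HasIndex m p d then h.choose else 0

/-! ### Permutations of rows and columns -/

/-- Compositions of finite sequences of `3`-cyclic permutations of rows or columns. -/
inductive IsThreeCycleComposition : (L → L) → Prop
  | nil : IsThreeCycleComposition id
  | rows {τ : L → L} (σ : Equiv.Perm (Fin 4)) (hσ : σ.IsThreeCycle)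
      (hτ : IsThreeCycleComposition τ) :
      IsThreeCycleComposition ((fun M : L => M.submatrix σ id) ∘ τ)
  | cols {τ : L → L} (σ : Equiv.Perm (Fin 4)) (hσ : σ.IsThreeCycle)
      (hτ : IsThreeCycleComposition τ) :
      IsThreeCycleComposition ((fun M : L => M.submatrix id σ) ∘ τ)

end

end RankTwo

/-!
The intersection index depends on `m` only through the compositions `g ∘ m` with oriented local
equations `g` of `Σ`, so it is invariant under every linear automorphism of `L` that preserves `Σ`
together with the orientation of its normal bundle. A permutation `e` of rows and columns is such
an automorphism. It preserves the rank, and permuting the entries of bases `l`, `k` of the left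
kernel and the kernel of `M` gives bases of the left kernel and the kernel of `e M` for which the
normal coordinates are unchanged: `l'ᵢ ⬝ (e F) k'ⱼ = lᵢ ⬝ F kⱼ` (`normalCoord_submatrix`). Hence
`e` maps positive normal frames to positive normal frames, `g ↦ g ∘ e⁻¹` maps oriented equations at
`M` to oriented equations at `e M` (`IsOrientedEquation.comp_permEquiv_symm`), and
`(g ∘ e⁻¹) ∘ (e ∘ m) = g ∘ m` has the same local degree as before.

The argument applies to arbitrary permutations of rows and columns; a composition of `3`-cycles is
a special case.
-/

namespace RankTwo

open Matrix

theorem submatrix_mem_Sig (σ ρ : Equiv.Perm (Fin 4)) {M : L} (hM : M ∈ Sig) :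
    M.submatrix σ ρ ∈ Sig :=
  (Matrix.rank_submatrix M σ ρ).trans hM

theorem linearIndependent_comp_perm (σ : Equiv.Perm (Fin 4)) {k : Fin 2 → Fin 4 → ℝ}
    (hk : LinearIndependent ℝ k) : LinearIndependent ℝ fun i => k i ∘ σ :=
  hk.map' (LinearEquiv.funCongrLeft ℝ ℝ σ).toLinearMap (LinearEquiv.ker _)

theorem submatrix_mulVec_comp (σ ρ : Equiv.Perm (Fin 4)) (M : L) (v : Fin 4 → ℝ) :
    M.submatrix σ ρ *ᵥ (v ∘ ρ) = (M *ᵥ v) ∘ σ := by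
  simp [Matrix.submatrix_mulVec_equiv, Function.comp_assoc]

theorem comp_vecMul_submatrix (σ ρ : Equiv.Perm (Fin 4)) (M : L) (v : Fin 4 → ℝ) :
    (v ∘ σ) ᵥ* M.submatrix σ ρ = (v ᵥ* M) ∘ ρ := by
  simp [Matrix.submatrix_vecMul_equiv, Function.comp_assoc]

theorem IsKernelBases.submatrix (σ ρ : Equiv.Perm (Fin 4)) {M : L} {l k : Fin 2 → Fin 4 → ℝ}
    (h : IsKernelBases M l k) :
    IsKernelBases (M.submatrix σ ρ) (fun i => l i ∘ σ) (fun j => k j ∘ ρ) where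
  left_indep := linearIndependent_comp_perm σ h.left_indep
  left_ker i := by rw [comp_vecMul_submatrix, h.left_ker]; rfl
  right_indep := linearIndependent_comp_perm ρ h.right_indep
  right_ker j := by rw [submatrix_mulVec_comp, h.right_ker]; rfl

theorem normalCoord_submatrix (σ ρ : Equiv.Perm (Fin 4)) (l k : Fin 2 → Fin 4 → ℝ)
    (F : Fin 2 × Fin 2 → L) :
    normalCoord (fun i => l i ∘ σ) (fun j => k j ∘ ρ) (fun b => (F b).submatrix σ ρ) =
      normalCoord l k F := by
  ext a b
  simp only [normalCoord, Matrix.of_apply, submatrix_mulVec_comp]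
  exact comp_equiv_dotProduct_comp_equiv _ _ σ

theorem IsPositiveNormalFrame.submatrix (σ ρ : Equiv.Perm (Fin 4)) {M : L}
    {F : Fin 2 × Fin 2 → L} (h : IsPositiveNormalFrame M F) :
    IsPositiveNormalFrame (M.submatrix σ ρ) (fun b => (F b).submatrix σ ρ) := by
  obtain ⟨l, k, hlk, hpos⟩ := h
  exact ⟨_, _, hlk.submatrix σ ρ, by rwa [normalCoord_submatrix]⟩

/-- The automorphism of `L` that permutes rows by `σ` and columns by `ρ`, with
`(permEquiv σ ρ M) i j = M (σ i) (ρ j)`. -/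
noncomputable def permEquiv (σ ρ : Equiv.Perm (Fin 4)) : L ≃L[ℝ] L :=
  (Matrix.reindexLinearEquiv ℝ ℝ σ.symm ρ.symm).toContinuousLinearEquiv

theorem permEquiv_apply (σ ρ : Equiv.Perm (Fin 4)) (M : L) :
    permEquiv σ ρ M = M.submatrix σ ρ := rfl

theorem permEquiv_symm (σ ρ : Equiv.Perm (Fin 4)) :
    (permEquiv σ ρ).symm = permEquiv σ.symm ρ.symm := rfl

theorem permEquiv_mem_Sig_iff (σ ρ : Equiv.Perm (Fin 4)) {M : L} :
    permEquiv σ ρ M ∈ Sig ↔ M ∈ Sig := by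
  refine ⟨fun h => ?_, submatrix_mem_Sig σ ρ⟩
  have := submatrix_mem_Sig σ.symm ρ.symm h
  rwa [← permEquiv_apply, ← permEquiv_symm, ContinuousLinearEquiv.symm_apply_apply] at this

/-- The chain rule for a linear change of variables. Stated for an abstract normed space because on
`L` the instances coming from the elementwise norm and those of `Matrix` agree only up to unfolding,
which prevents rewriting under `fderiv`. -/
theorem fderiv_comp_symm_apply {E F : Type*} [NormedAddCommGroup E] [NormedSpace ℝ E]
    [NormedAddCommGroup F] [NormedSpace ℝ F] (e : E ≃L[ℝ] E) (g : E → F) (x v : E) :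
    fderiv ℝ (g ∘ e.symm) (e x) (e v) = fderiv ℝ g x v := by
  rw [ContinuousLinearEquiv.comp_right_fderiv]
  simp

theorem IsOrientedEquation.comp_permEquiv_symm (σ ρ : Equiv.Perm (Fin 4)) {g : L → E4} {M : L}
    (h : IsOrientedEquation g M) :
    IsOrientedEquation (g ∘ (permEquiv σ ρ).symm) (permEquiv σ ρ M) where
  mem := (permEquiv_mem_Sig_iff σ ρ).2 h.mem
  contDiffAt := by
    refine ContDiffAt.comp _ ?_ (permEquiv σ ρ).symm.contDiff.contDiffAt
    simpa using h.contDiffAt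
  eq_zero_iff := by
    have hc : Tendsto (permEquiv σ ρ).symm (𝓝 (permEquiv σ ρ M)) (𝓝 M) := by
      simpa using (permEquiv σ ρ).symm.continuous.tendsto (permEquiv σ ρ M)
    filter_upwards [hc.eventually h.eq_zero_iff] with N hN
    rw [Function.comp_apply, hN, permEquiv_symm, permEquiv_mem_Sig_iff]
  oriented := by
    obtain ⟨F, hF, hpos⟩ := h.oriented
    refine ⟨fun b => permEquiv σ ρ (F b), hF.submatrix σ ρ, ?_⟩
    have hfd : ∀ X : L, fderiv ℝ (g ∘ (permEquiv σ ρ).symm) (permEquiv σ ρ M) (permEquiv σ ρ X) =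
        fderiv ℝ g M X := fderiv_comp_symm_apply (permEquiv σ ρ) g M
    simpa only [hfd] using hpos

theorem HasIndex.permEquiv (σ ρ : Equiv.Perm (Fin 4)) {m : E4 → L} {p : E4} {d : ℤ}
    (h : HasIndex m p d) : HasIndex (permEquiv σ ρ ∘ m) p d := by
  obtain ⟨g, hg, hd⟩ := h
  refine ⟨_, hg.comp_permEquiv_symm σ ρ, ?_⟩
  have : (g ∘ (RankTwo.permEquiv σ ρ).symm) ∘ (RankTwo.permEquiv σ ρ ∘ m) = g ∘ m := by
    ext1 x
    simp
  rwa [this]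

theorem hasIndex_permEquiv_iff (σ ρ : Equiv.Perm (Fin 4)) {m : E4 → L} {p : E4} {d : ℤ} :
    HasIndex (permEquiv σ ρ ∘ m) p d ↔ HasIndex m p d := by
  refine ⟨fun h => ?_, HasIndex.permEquiv σ ρ⟩
  have := h.permEquiv σ.symm ρ.symm
  rwa [← permEquiv_symm, ← Function.comp_assoc, ContinuousLinearEquiv.symm_comp_self,
    Function.id_comp] at this

theorem IsThreeCycleComposition.exists_eq_permEquiv {τ : L → L}
    (h : IsThreeCycleComposition τ) : ∃ σ ρ : Equiv.Perm (Fin 4), τ = permEquiv σ ρ := by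
  induction h with
  | nil => exact ⟨1, 1, rfl⟩
  | rows σ _ _ ih =>
    obtain ⟨σ', ρ', rfl⟩ := ih
    exact ⟨σ' * σ, ρ', rfl⟩
  | cols σ _ _ ih =>
    obtain ⟨σ', ρ', rfl⟩ := ih
    exact ⟨σ', ρ' * σ, rfl⟩

end RankTwo

theorem mainTheorem2 (V : Set RankTwo.E4) (hV : IsOpen V) (h0V : (0 : RankTwo.E4) ∈ V)
    (m : RankTwo.E4 → RankTwo.L) (hm : ContinuousOn m V)
    (h0 : m 0 ∈ RankTwo.Sig) (hiso : ∀ᶠ x in 𝓝[≠] (0 : RankTwo.E4), m x ∉ RankTwo.Sig)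
    (τ : RankTwo.L → RankTwo.L) (hτ : RankTwo.IsThreeCycleComposition τ)
    (hτU : τ (m 0) ∈ RankTwo.Sig ∩ RankTwo.U) :
    (∀ d : ℤ, RankTwo.HasIndex m 0 d ↔ RankTwo.HasIndex (τ ∘ m) 0 d) ∧
      RankTwo.index m 0 = RankTwo.index (τ ∘ m) 0 := by
  obtain ⟨σ, ρ, rfl⟩ := hτ.exists_eq_permEquiv
  have h : ∀ d : ℤ, RankTwo.HasIndex m 0 d ↔
      RankTwo.HasIndex (RankTwo.permEquiv σ ρ ∘ m) 0 d :=
    fun d => (RankTwo.hasIndex_permEquiv_iff σ ρ).symm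
  refine ⟨h, ?_⟩
  -- The index is determined by the predicate `HasIndex`, whether or not a unique `d` exists.
  have hp : RankTwo.HasIndex m 0 = RankTwo.HasIndex (RankTwo.permEquiv σ ρ ∘ m) 0 :=
    funext fun d => propext (h d)
  unfold RankTwo.index
  generalize RankTwo.HasIndex m 0 = P at hp
  subst hp
  rfl
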